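/- Let $a,b,c\ge 1$ be integers and let $H_{a,b,c}$ be the hexagon with side lengths $a,b,c,a,b,c$ (clockwise from the south-west side) on the unit triangular lattice, drawn so that one family of lines is vertical. Let $L_-$ and $L_+$ be the families of lattice lines in the polar directions $-\pi/6$ and $\pi/6$. Label the lines of each family from left to right, consecutive labels differing by $1$, so that $H_{a,b,c}$ is the region enclosed by the lines $\pm\frac{b+c}{2}$ of $L_-$, $\pm\frac{a+b}{2}$ of $L_+$ and the vertical lines $\pm\frac{a+c}{2}$. Let $G=G_{a,b,c}$ be the corresponding hexagonal subgraph of the honeycomb lattice: its black (white) vertices are the left (right) pointing unit triangles contained in $H_{a,b,c}$, and a black and a white vertex are adjacent when the two triangles share an edge. The orientation of all edges from black to white is admissible, so the Kasteleyn matrix $A_G$ of $G$ is its bi-adjacency matrix: rows are indexed by black vertices, columns by white vertices, and entries are $1$ for adjacent pairs and $0$ otherwise. Each vertex $v$ is given the coordinates $\psi(l,l',l'')=\left(\frac{l+l'+l''}{2},\frac{l-l'-l''}{2}\right)$, where $l,l',l''$ are the labels of the lines of $L_-$, of $L_+$ and of the vertical line that bound the triangle $v$. Set $\binom nk=\frac{n!}{(n-k)!\,k!}$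 if $n,k$ are nonnegative integers with $k\le n$, and $\binom nk=0$ otherwise, and let $$g(u,v,w,x,y,z)=\sum_{s=1}^{z}(-1)^{z-s}\binom{v+s-1}{s-1}\binom{w+z-s-1}{w-1}\binom{\frac v2+\frac w2+x+y}{x-s+\frac u2+\frac w2+\frac12}.$$ For a white vertex $\omega$ with coordinates $(i_x,i_y)$ and a black vertex $\beta$ with coordinates $(j_x,j_y)$ put $$E(\omega,\beta)=\binom{j_x+j_y-i_x-i_y}{j_x-i_x}-\sum_{t=1}^{a}\frac{g(a,b,c,j_x,j_y,t)\,g(a,c,b,-i_y,-i_x,t)}{\binom{b+c+t-1}{b+t-1}\binom{b+t-1}{t-1}}.$$ Then $G$ has $n=ab+bc+ca$ vertices of each colour, $A_G$ is invertible, and its inverse is the matrix $K$ with rows indexed by white and columns by black vertices and with entries $$K_{\omega,\beta}=(-1)^{j_x+j_y-i_x-i_y}\,E(\omega,\beta)$$ (the exponent is an integer: it is the difference $l_\beta-l_\omega$ of the labels of the $L_-$ lines of $\beta$ and $\omega$). In particular, let the vertices be labelled $b_1,\dots,b_n$ and $w_1,\dots,w_n$ consistently, in the sense that two vertices of the same colour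 have labels of the same parity if and only if the labels of their $L_-$ lines differ by an even number. Then $A_G^{-1}$ equals $K'$ or $-K'$, where $K'_{w_i,b_j}=(-1)^{i+j}E(w_i,b_j)$. -/

import Mathlib

namespace HexKasteleyn

/-! The unit triangular lattice has three families of lines: `L₋` (polar direction `-π/6`),
`L₊` (polar direction `π/6`) and the vertical lines. The hexagon with side lengths `a, b, c, a, b, c`
(clockwise from the south-west side) has its south-west and north-east sides (length `a`) on lines
of `L₋`, its north-west and south-east sides (length `c`) on lines of `L₊`, and its west and east
sides (length `b`) on vertical lines. In each family the lines that meet the hexagon are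
numbered from left to right by consecutive integers, the leftmost one (which carries a side) being
number `0`. Line number `u` of `L₋` and line number `v` of `L₊` meet in a lattice point `(u, v)`,
which lies on the vertical line number `u + v - b`. -/

/-- The lattice point `(u, v)` lies in the closed hexagon: the numbers of the three lines
through it satisfy `0 ≤ u ≤ b + c`, `0 ≤ v ≤ a + b` and `0 ≤ u + v - b ≤ a + c`. -/
def InHexagon (a b c : ℕ) (P : ℤ × ℤ) : Prop :=
  (0 ≤ P.1 ∧ P.1 ≤ b + c) ∧ (0 ≤ P.2 ∧ P.2 ≤ a + b) ∧
    (0 ≤ P.1 + P.2 - b ∧ P.1 + P.2 - b ≤ a + c)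

instance (a b c : ℕ) (P : ℤ × ℤ) : Decidable (InHexagon a b c P) := by
  unfold InHexagon; infer_instance

/-- The corners of the left pointing unit triangle whose south-west side lies on line number
`k.1` of `L₋` and whose north-west side lies on line number `k.2` of `L₊`. Its vertical side lies
on the vertical line number `k.1 + k.2 + 1 - b`. -/
def leftTriangle (k : ℤ × ℤ) : Finset (ℤ × ℤ) := {(k.1, k.2), (k.1 + 1, k.2), (k.1, k.2 + 1)}

/-- The corners of the right pointing unit triangle whose north-east side lies on line number
`k.1` of `L₋` and whose south-east side lies on line number `k.2` of `L₊`. Its vertical side lies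
on the vertical line number `k.1 + k.2 - 1 - b`. -/
def rightTriangle (k : ℤ × ℤ) : Finset (ℤ × ℤ) := {(k.1, k.2), (k.1 - 1, k.2), (k.1, k.2 - 1)}

/-- The left pointing unit triangles in the hexagon. -/
noncomputable def leftTriangles (a b c : ℕ) : Finset (ℤ × ℤ) :=
  (Finset.Icc (0 : ℤ) (b + c) ×ˢ Finset.Icc (0 : ℤ) (a + b)).filter
    fun k => ∀ P ∈ leftTriangle k, InHexagon a b c P

/-- The right pointing unit triangles in the hexagon. -/
noncomputable def rightTriangles (a b c : ℕ) : Finset (ℤ × ℤ) :=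
  (Finset.Icc (0 : ℤ) (b + c) ×ˢ Finset.Icc (0 : ℤ) (a + b)).filter
    fun k => ∀ P ∈ rightTriangle k, InHexagon a b c P

theorem mem_leftTriangles {a b c : ℕ} {k : ℤ × ℤ} :
    k ∈ leftTriangles a b c ↔ ∀ P ∈ leftTriangle k, InHexagon a b c P := by
  simp only [leftTriangles, Finset.mem_filter, Finset.mem_product, Finset.mem_Icc,
    and_iff_right_iff_imp]
  intro h
  have := h k (by simp [leftTriangle])
  exact ⟨this.1, this.2.1⟩

theorem mem_rightTriangles {a b c : ℕ} {k : ℤ × ℤ} :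
    k ∈ rightTriangles a b c ↔ ∀ P ∈ rightTriangle k, InHexagon a b c P := by
  simp only [rightTriangles, Finset.mem_filter, Finset.mem_product, Finset.mem_Icc,
    and_iff_right_iff_imp]
  intro h
  have := h k (by simp [rightTriangle])
  exact ⟨this.1, this.2.1⟩

/-- The black vertices of the hexagonal subgraph of the honeycomb lattice, the dual of the
triangular lattice: the (centres of the) left pointing unit triangles in the hexagon. -/
abbrev Black (a b c : ℕ) : Type := {k : ℤ × ℤ // k ∈ leftTriangles a b c}

/-- The white vertices: the (centres of the) right pointing unit triangles in the hexagon. -/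
abbrev White (a b c : ℕ) : Type := {k : ℤ × ℤ // k ∈ rightTriangles a b c}

/-- A black and a white vertex are adjacent if the two triangles share an edge, that is, exactly
two corners. -/
def Adj {a b c : ℕ} (β : Black a b c) (ω : White a b c) : Prop :=
  (leftTriangle β.1 ∩ rightTriangle ω.1).card = 2

instance {a b c : ℕ} (β : Black a b c) (ω : White a b c) : Decidable (Adj β ω) := by
  unfold Adj; infer_instance

/-- The Kasteleyn matrix: the bi-adjacency matrix, rows indexed by the black vertices and columns
by the white ones. -/
def kasteleyn (a b c : ℕ) : Matrix (Black a b c) (White a b c) ℚ :=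
  Matrix.of fun β ω => if Adj β ω then 1 else 0

/-- The labels `(l, l', l'')` of the lines of `L₋`, of `L₊` and of the vertical line that bound the
triangle of a black vertex: the line numbers, shifted so that the centre of the hexagon has
label `0` in each family. -/
def Black.label {a b c : ℕ} (β : Black a b c) : ℚ × ℚ × ℚ :=
  ((β.1.1 : ℚ) - ((b : ℚ) + c) / 2, (β.1.2 : ℚ) - ((a : ℚ) + b) / 2,
    ((β.1.1 : ℚ) + β.1.2 + 1 - b) - ((a : ℚ) + c) / 2)

/-- The labels of the three lines that bound the triangle of a white vertex. -/
def White.label {a b c : ℕ} (ω : White a b c) : ℚ × ℚ × ℚ :=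
  ((ω.1.1 : ℚ) - ((b : ℚ) + c) / 2, (ω.1.2 : ℚ) - ((a : ℚ) + b) / 2,
    ((ω.1.1 : ℚ) + ω.1.2 - 1 - b) - ((a : ℚ) + c) / 2)

/-- The map from line labels to lattice path coordinates. -/
def psi (t : ℚ × ℚ × ℚ) : ℚ × ℚ :=
  ((t.1 + t.2.1 + t.2.2) / 2, (t.1 - t.2.1 - t.2.2) / 2)

/-- The binomial coefficient `n! / ((n - k)! k!)` if `n` and `k` are nonnegative integers with
`k ≤ n`, and `0` otherwise. -/
def binom (n k : ℚ) : ℚ :=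
  if n.den = 1 ∧ k.den = 1 ∧ 0 ≤ k ∧ k ≤ n then (Nat.choose n.num.toNat k.num.toNat : ℚ) else 0

/-- The sum `g(u, v, w, x, y, z)`. -/
def g (u v w : ℕ) (x y : ℚ) (z : ℕ) : ℚ :=
  ∑ s ∈ Finset.Icc 1 z, (-1 : ℚ) ^ (z - s) * binom ((v : ℚ) + s - 1) ((s : ℚ) - 1) *
    binom ((w : ℚ) + z - s - 1) ((w : ℚ) - 1) *
    binom ((v : ℚ) / 2 + (w : ℚ) / 2 + x + y) (x - s + (u : ℚ) / 2 + (w : ℚ) / 2 + 1 / 2)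

/-- The entry in row `ω` and column `β` of the inverse Kasteleyn matrix, without its sign;
`i` and `j` are the lattice path coordinates of `ω` and of `β`. -/
def entry {a b c : ℕ} (ω : White a b c) (β : Black a b c) : ℚ :=
  let i : ℚ × ℚ := psi (White.label ω)
  let j : ℚ × ℚ := psi (Black.label β)
  binom (j.1 + j.2 - i.1 - i.2) (j.1 - i.1) -
    ∑ t ∈ Finset.Icc 1 a, g a b c j.1 j.2 t * g a c b (-i.2) (-i.1) t /
      (binom ((b : ℚ) + c + t - 1) ((b : ℚ) + t - 1) * binom ((b : ℚ) + t - 1) ((t : ℚ) - 1))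

/-- The matrix `K`, independent of any labelling of the vertices: the sign is `(-1)` to the power
`j_x + j_y - i_x - i_y`, the difference of the labels of the `L₋` lines of `β` and `ω`. -/
def K (a b c : ℕ) : Matrix (White a b c) (Black a b c) ℚ :=
  Matrix.of fun ω β => (-1 : ℚ) ^ (β.1.1 - ω.1.1) * entry ω β

/-- The matrix `K` for a labelling `w₁, …, wₙ` and `b₁, …, bₙ` of the vertices: the sign
is `(-1) ^ (i + j)`. Labels start at `1`, elements of `Fin n` at `0`. -/
def labelledK {a b c n : ℕ} (w : Fin n ≃ White a b c) (B : Fin n ≃ Black a b c) :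
    Matrix (Fin n) (Fin n) ℚ :=
  Matrix.of fun i j => (-1 : ℚ) ^ (((i : ℕ) + 1) + ((j : ℕ) + 1)) * entry (w i) (B j)

/-- A labelling of vertices is consistent with the lines of `L₋` if two labels have the same parity
exactly when the numbers of the `L₋` lines through the two vertices have the same parity. -/
def Consistent {n : ℕ} (line : Fin n → ℤ) : Prop :=
  ∀ i i' : Fin n, Even (((i : ℕ) : ℤ) - ((i' : ℕ) : ℤ)) ↔ Even (line i - line i')

end HexKasteleyn

namespace HexKasteleyn

open Finset

/-! The two colour classes are equinumerous, so it suffices that `K` is a right inverse of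
`kasteleyn`. The black triangle `(u', v')` can only have the white neighbours `(u', v' + 1)`, `(u' +
1, v' + 1)`, `(u' + 1, v')`. With the signs of `K`, the product is therefore Pascal's rule in the
white position, with a delta source at the black one.

In `greenEntry` the leading binomial supplies the source (`intBinom_pascal`), and the subtracted sum
solves the homogeneous rule (`corner_pascal`). It remains to see that `greenEntry` vanishes at
neighbours outside the hexagon. Beyond two of the sides every term is zero by its support. Beyond
the south-west side the sum must reproduce the binomial, which means that the coefficients of `g`
and the denominators assemble into the inverse of `pathMatrix` (`upperCoeff_mul_pathMatrix`). This
is a triangular factorization of `pathMatrix`, and its entries are an instance of the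
Pfaff–Saalschütz summation. -/

/-! ### Binomial identities. -/

/-- A form of Pfaff–Saalschütz. Vandermonde splits `(b + c + n).choose n` into a sum over `j`; after
exchanging the sums, Vandermonde evaluates the sum over `n` and then the one over `j`. -/
theorem sum_choose_mul_choose_mul_choose (b c S R : ℕ) :
    ∑ n ∈ range (S + 1), (if n ≤ R then b.choose (S - n) * c.choose (R - n) else 0) *
      (b + c + n).choose n = (c + S).choose R * (b + R).choose S := by
  have inner : ∀ n ∈ range (S + 1), b.choose (S - n) * (b + c + n).choose n =
      ∑ j ∈ range (n + 1), b.choose (S - j) * (S - j).choose (n - j) * (c + S).choose j := by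
    intro n hn
    have hn : n ≤ S := by simpa [Nat.lt_succ_iff] using hn
    have key : ∀ j ∈ range (n + 1), b.choose (S - j) * (S - j).choose (n - j) * (c + S).choose j
        = b.choose (S - n) * ((c + S).choose j * (b - (S - n)).choose (n - j)) := by
      intro j hj
      have hj : j ≤ n := by simpa [Nat.lt_succ_iff] using hj
      have h1 := Nat.choose_mul (n := b) (k := S - j) (s := S - n) (by omega)
      rw [show S - j - (S - n) = n - j by omega,
        ← Nat.choose_symm_of_eq_add (show S - j = (n - j) + (S - n) by omega)] at h1
      rw [h1]; ring
    rw [sum_congr rfl key, ← mul_sum]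
    -- For `b < S - n` the subtraction `b - (S - n)` truncates, but the common factor `b.choose (S -
    -- n)` is zero.
    by_cases hb : S - n ≤ b
    · rw [show b + c + n = (c + S) + (b - (S - n)) by omega, Nat.add_choose_eq,
        Nat.sum_antidiagonal_eq_sum_range_succ
          (fun i j => (c + S).choose i * (b - (S - n)).choose j)]
    · simp [Nat.choose_eq_zero_of_lt (not_le.mp hb)]
  have outer : ∀ j ∈ range (S + 1), b.choose (S - j) * R.choose j * (c + S).choose R =
      ∑ n ∈ Icc j S, (if n ≤ R then c.choose (R - n) else 0) *
        (b.choose (S - j) * (S - j).choose (n - j) * (c + S).choose j) := by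
    intro j hj
    have hj : j ≤ S := by simpa [Nat.lt_succ_iff] using hj
    by_cases hR : j ≤ R
    · have h1 := Nat.choose_mul (n := c + S) (k := R) (s := j) hR
      have h2 : (c + S - j).choose (R - j) =
          ∑ n ∈ Icc j S, (if n ≤ R then c.choose (R - n) else 0) * (S - j).choose (n - j) := by
        rw [show c + S - j = (S - j) + c by omega, Nat.add_choose_eq,
          Nat.sum_antidiagonal_eq_sum_range_succ (fun i k => (S - j).choose i * c.choose k)]
        have e1 : ∑ i ∈ range (R - j).succ, (S - j).choose i * c.choose (R - j - i) =
            ∑ n ∈ Ico j (R + 1), (S - j).choose (n - j) * c.choose (R - n) := by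
          rw [sum_Ico_eq_sum_range, show R + 1 - j = (R - j).succ by omega]
          refine sum_congr rfl fun i hi => ?_
          rw [show j + i - j = i by omega, show R - (j + i) = R - j - i by omega]
        rw [e1]
        -- The bound `max R S` covers both ranges of summation; the extra terms are zero.
        have e2 : ∑ n ∈ Ico j (R + 1), (S - j).choose (n - j) * c.choose (R - n) =
            ∑ n ∈ Icc j (max R S), (if n ≤ R then c.choose (R - n) else 0) *
              (S - j).choose (n - j) := by
          refine sum_subset_zero_on_sdiff (fun n => by simp; omega) ?_ ?_
          · intro n hn
            simp only [mem_sdiff, mem_Icc, mem_Ico] at hn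
            rw [if_neg (by omega), zero_mul]
          · intro n hn
            simp only [mem_Ico] at hn
            rw [if_pos (by omega), mul_comm]
        rw [e2]
        symm
        refine sum_subset (fun n => by simp; omega) ?_
        intro n hn hn'
        simp only [mem_Icc] at hn hn'
        rw [Nat.choose_eq_zero_of_lt (show S - j < n - j by omega), mul_zero]
      rw [mul_assoc, mul_comm (R.choose j), h1, h2, mul_sum, mul_sum]
      exact sum_congr rfl fun n _ => by ring
    · rw [Nat.choose_eq_zero_of_lt (not_le.mp hR), mul_zero, zero_mul]
      symm
      refine sum_eq_zero fun n hn => ?_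
      simp only [mem_Icc] at hn
      rw [if_neg (by omega), zero_mul]
  have vdm : (b + R).choose S = ∑ j ∈ range (S + 1), b.choose (S - j) * R.choose j := by
    rw [add_comm, Nat.add_choose_eq,
      Nat.sum_antidiagonal_eq_sum_range_succ (fun i k => R.choose i * b.choose k)]
    exact sum_congr rfl fun n _ => by ring
  rw [vdm, mul_comm, sum_mul, sum_congr rfl outer]
  rw [sum_comm' (t' := range (S + 1)) (s' := fun n => range (n + 1))
    (by intro x y; simp; omega)]
  refine sum_congr rfl fun n hn => ?_
  rw [← mul_sum, ← inner n hn]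
  split_ifs <;> ring

/-- Compare coefficients in `(1 - X)⁻ᶜ (1 - X)ᶜ = 1` and multiply by `(-1) ^ n`. -/
theorem sum_neg_one_pow_mul_choose (c n : ℕ) (hc : 0 < c) :
    ∑ ij ∈ antidiagonal n, (-1 : ℚ) ^ ij.1 * (c - 1 + ij.1).choose (c - 1) * c.choose ij.2 =
      if n = 0 then 1 else 0 := by
  obtain ⟨d, rfl⟩ : ∃ d, c = d + 1 := ⟨c - 1, by omega⟩
  have h := congrArg (PowerSeries.coeff n) ((PowerSeries.invOneSubPow ℚ (d + 1)).val_inv)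
  rw [PowerSeries.invOneSubPow_val_succ_eq_mk_add_choose,
    PowerSeries.invOneSubPow_inv_eq_one_sub_pow, PowerSeries.coeff_mul, PowerSeries.coeff_one] at h
  have h2 : ∀ k, PowerSeries.coeff k ((1 - PowerSeries.X : PowerSeries ℚ) ^ (d + 1)) =
      (-1) ^ k * ((d + 1).choose k : ℚ) := by
    intro k
    have h1 : ((1 - PowerSeries.X : PowerSeries ℚ) ^ (d + 1)) = PowerSeries.rescale (-1 : ℚ)
        (((1 + Polynomial.X : Polynomial ℚ) ^ (d + 1) : Polynomial ℚ) : PowerSeries ℚ) := by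
      push_cast
      rw [map_pow, map_add, map_one, PowerSeries.rescale_neg_one_X, sub_eq_add_neg]
    rw [h1, PowerSeries.coeff_rescale, Polynomial.coeff_coe, Polynomial.coeff_one_add_X_pow]
  simp only [h2, PowerSeries.coeff_mk] at h
  have h3 := congrArg (fun x => (-1 : ℚ) ^ n * x) h
  simp only [mul_sum] at h3
  rw [show (-1 : ℚ) ^ n * (if n = 0 then 1 else 0) = if n = 0 then 1 else 0 by
    split_ifs with h0 <;> simp [h0]] at h3
  rw [← h3]
  refine sum_congr rfl fun ij hij => ?_
  rw [HasAntidiagonal.mem_antidiagonal] at hij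
  rw [← hij, pow_add]
  have : (-1 : ℚ) ^ ij.2 * (-1) ^ ij.2 = 1 := by rw [← mul_pow]; simp
  simp only [Nat.add_sub_cancel]
  linear_combination (-(-1 : ℚ) ^ ij.1 * (d + ij.1).choose d * (d + 1).choose ij.2) * this

/-! ### Zero-extended binomial coefficients. -/

/-- The binomial coefficient with integer arguments, zero outside the range `0 ≤ k ≤ n`. -/
def intBinom (n k : ℤ) : ℚ := if 0 ≤ k ∧ k ≤ n then (n.toNat.choose k.toNat : ℚ) else 0

theorem binom_intCast (n k : ℤ) : binom (n : ℚ) (k : ℚ) = intBinom n k := by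
  simp [binom, intBinom]

theorem binom_natCast (n k : ℕ) : binom (n : ℚ) (k : ℚ) = n.choose k := by
  have h := binom_intCast n k
  simp only [Int.cast_natCast] at h
  rw [h, intBinom]
  split_ifs with h1
  · simp
  · rw [Nat.choose_eq_zero_of_lt (by omega), Nat.cast_zero]

theorem intBinom_of_neg {n k : ℤ} (h : k < 0) : intBinom n k = 0 :=
  if_neg (by omega)

theorem intBinom_of_lt {n k : ℤ} (h : n < k) : intBinom n k = 0 :=
  if_neg (by omega)

theorem intBinom_natCast (n k : ℕ) : intBinom n k = n.choose k := by
  rw [← binom_intCast]; exact_mod_cast binom_natCast n k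

/-- Extension by zero breaks Pascal's rule only at the apex of the triangle; this defect becomes the
identity matrix. -/
theorem intBinom_pascal (n k : ℤ) :
    intBinom n k - intBinom (n - 1) k - intBinom (n - 1) (k - 1) =
      if n = 0 ∧ k = 0 then 1 else 0 := by
  rcases lt_trichotomy k 0 with hk | rfl | hk
  · rw [intBinom_of_neg hk, intBinom_of_neg hk, intBinom_of_neg (by omega), if_neg (by omega)]
    norm_num
  · rw [intBinom_of_neg (k := 0 - 1) (by omega)]
    rcases lt_trichotomy n 0 with hn | rfl | hn
    · rw [intBinom_of_lt hn, intBinom_of_lt (by omega), if_neg (by omega)]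
      norm_num
    · simp [intBinom]
    · rw [if_neg (by omega), intBinom, intBinom, if_pos (by omega), if_pos (by omega)]
      simp
  · rw [if_neg (by omega)]
    obtain ⟨m, rfl⟩ : ∃ m : ℕ, k = m + 1 := ⟨(k - 1).toNat, by omega⟩
    rcases le_or_gt n 0 with hn | hn
    · rw [intBinom_of_lt (by omega), intBinom_of_lt (by omega), intBinom_of_lt (by omega)]
      norm_num
    · obtain ⟨N, rfl⟩ : ∃ N : ℕ, n = N + 1 := ⟨(n - 1).toNat, by omega⟩
      simp only [add_sub_cancel_right]
      have h1 := intBinom_natCast (N + 1) (m + 1)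
      have h2 := intBinom_natCast N (m + 1)
      push_cast at h1 h2
      rw [h1, h2, intBinom_natCast, Nat.choose_succ_succ]
      push_cast; ring

/-! ### Triangular factorization of the path matrix. -/

/-- The upper triangular matrix of the coefficients of `g`. -/
def upperCoeff (a b c : ℕ) : Matrix (Fin a) (Fin a) ℚ :=
  Matrix.of fun i j => if (i : ℕ) ≤ j then
    (-1 : ℚ) ^ ((j : ℕ) - i) * (b + i).choose i * (c - 1 + (j - i)).choose (c - 1) else 0

/-- The inverse of `upperCoeff`. -/
def upperCoeffInv (a b c : ℕ) : Matrix (Fin a) (Fin a) ℚ :=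
  Matrix.of fun i j => if (i : ℕ) ≤ j then (c.choose (j - i) : ℚ) / (b + j).choose j else 0

/-- The diagonal of denominators. -/
def denom (b c i : ℕ) : ℚ := (b + c + i).choose (b + i) * (b + i).choose i

theorem denom_ne_zero (b c i : ℕ) : denom b c i ≠ 0 := by
  have h1 := Nat.choose_pos (show b + i ≤ b + c + i by omega)
  have h2 := Nat.choose_pos (show i ≤ b + i by omega)
  unfold denom; positivity

/-- The numbers of lattice paths between opposite sides. -/
def pathMatrix (a b c : ℕ) : Matrix (Fin a) (Fin a) ℚ :=
  Matrix.of fun i j => intBinom (b + c) (b + j - i)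

theorem denom_eq (b c i : ℕ) : denom b c i = (b + c + i).choose i * (b + c).choose b := by
  unfold denom
  have h := Nat.choose_mul (n := b + c + i) (k := b + i) (s := i) (by omega)
  rw [show b + c + i - i = b + c by omega, show b + i - i = b by omega] at h
  exact_mod_cast h

/-- The factors are the Toeplitz matrices of `(1 + X)⁻ᶜ` and `(1 + X)ᶜ`, the first with rows
multiplied and the second with columns divided by `(b + i).choose i`. -/
theorem upperCoeff_mul_upperCoeffInv (a b c : ℕ) (hc : 0 < c) :
    upperCoeff a b c * upperCoeffInv a b c = 1 := by
  ext i k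
  rw [Matrix.mul_apply, Matrix.one_apply]
  simp only [upperCoeff, upperCoeffInv, Matrix.of_apply]
  rw [Fin.sum_univ_eq_sum_range (fun j => (if (i : ℕ) ≤ j then (-1 : ℚ) ^ (j - (i : ℕ)) *
    (b + i).choose i * (c - 1 + (j - i)).choose (c - 1) else 0) *
    (if j ≤ (k : ℕ) then (c.choose (k - j) : ℚ) / (b + k).choose k else 0)) a]
  by_cases hik : (i : ℕ) ≤ k
  · have h := sum_neg_one_pow_mul_choose c (k - i) hc
    rw [Nat.sum_antidiagonal_eq_sum_range_succ
      (fun x y => (-1 : ℚ) ^ x * (c - 1 + x).choose (c - 1) * c.choose y)] at h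
    have e : ∑ j ∈ range a, (if (i : ℕ) ≤ j then (-1 : ℚ) ^ (j - (i : ℕ)) *
        (b + i).choose i * (c - 1 + (j - i)).choose (c - 1) else 0) *
        (if j ≤ (k : ℕ) then (c.choose (k - j) : ℚ) / (b + k).choose k else 0) =
        ∑ j ∈ Ico (i : ℕ) (k + 1), (-1 : ℚ) ^ (j - (i : ℕ)) *
        (b + i).choose i * (c - 1 + (j - i)).choose (c - 1) *
        ((c.choose (k - j) : ℚ) / (b + k).choose k) := by
      symm
      refine sum_subset_zero_on_sdiff (fun j => by simp; omega) ?_ ?_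
      · intro j hj
        simp only [mem_sdiff, mem_Ico, mem_range] at hj
        by_cases h1 : (i : ℕ) ≤ j
        · rw [if_neg (show ¬ j ≤ (k : ℕ) by omega), mul_zero]
        · rw [if_neg h1, zero_mul]
      · intro j hj
        simp only [mem_Ico] at hj
        rw [if_pos hj.1, if_pos (by omega)]
    rw [e, sum_Ico_eq_sum_range, show (k : ℕ) + 1 - i = (k - i : ℕ).succ by omega]
    have e2 : ∀ x ∈ range (k - i : ℕ).succ, (-1 : ℚ) ^ ((i : ℕ) + x - i) *
        (b + i).choose i * (c - 1 + ((i : ℕ) + x - i)).choose (c - 1) *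
        ((c.choose (k - (i + x)) : ℚ) / (b + k).choose k) =
        ((b + i).choose i : ℚ) / (b + k).choose k *
        ((-1 : ℚ) ^ x * (c - 1 + x).choose (c - 1) * c.choose (k - i - x)) := by
      intro x _
      rw [show (i : ℕ) + x - i = x by omega, show (k : ℕ) - (i + x) = k - i - x by omega]
      ring
    rw [sum_congr rfl e2, ← mul_sum, h]
    by_cases h0 : i = k
    · subst h0
      have : ((b + i).choose i : ℚ) ≠ 0 := by
        exact_mod_cast (Nat.choose_pos (show (i : ℕ) ≤ b + i by omega)).ne'
      simp [this]
    · rw [if_neg h0, if_neg (by omega), mul_zero]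
  · rw [if_neg (by intro h; subst h; omega)]
    refine sum_eq_zero fun j _ => ?_
    by_cases h1 : (i : ℕ) ≤ j
    · rw [if_neg (show ¬ j ≤ (k : ℕ) by omega), mul_zero]
    · rw [if_neg h1, zero_mul]

/-- Both sides are the same quotient of factorials, or both zero. It identifies the Saalschütz
product with a normalized entry of `pathMatrix`. -/
theorem choose_mul_choose_mul_choose_eq (b c s r : ℕ) :
    (((c + s).choose r * (b + r).choose s * (b + c).choose b : ℕ) : ℚ) =
      intBinom (b + c) (b + r - s) * (c + s).choose s * (b + r).choose r := by
  by_cases h1 : c + s < r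
  · rw [Nat.choose_eq_zero_of_lt h1, intBinom_of_lt (by omega)]; simp
  by_cases h2 : b + r < s
  · rw [Nat.choose_eq_zero_of_lt h2, intBinom_of_neg (by omega)]; simp
  obtain ⟨x, hx⟩ : ∃ x, c + s = r + x := ⟨c + s - r, by omega⟩
  obtain ⟨y, hy⟩ : ∃ y, b + r = s + y := ⟨b + r - s, by omega⟩
  have hbin : intBinom (b + c) (b + r - s) = (b + c).choose y := by
    rw [← intBinom_natCast]; congr 1
    omega
  have hxy : b + c = y + x := by omega
  have f1 : ((c + s).choose r : ℚ) = (c + s).factorial / (r.factorial * x.factorial) := by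
    rw [hx, Nat.cast_add_choose]
  have f2 : ((b + r).choose s : ℚ) = (b + r).factorial / (s.factorial * y.factorial) := by
    rw [hy, Nat.cast_add_choose]
  have f3 : ((b + c).choose y : ℚ) = (b + c).factorial / (y.factorial * x.factorial) := by
    rw [hxy, Nat.cast_add_choose]
  have f4 : ((c + s).choose s : ℚ) = (c + s).factorial / (s.factorial * c.factorial) := by
    rw [add_comm c, Nat.cast_add_choose]
  have f5 : ((b + r).choose r : ℚ) = (b + r).factorial / (r.factorial * b.factorial) := by
    rw [add_comm b, Nat.cast_add_choose]
  rw [hbin]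
  push_cast
  rw [f1, f2, f3, f4, f5, Nat.cast_add_choose]
  field_simp

theorem transpose_mul_diagonal_mul (a b c : ℕ) :
    (upperCoeffInv a c b).transpose * Matrix.diagonal (fun i : Fin a => denom b c i) *
      upperCoeffInv a b c = pathMatrix a b c := by
  ext s r
  rw [Matrix.mul_apply]
  simp only [Matrix.mul_diagonal, Matrix.transpose_apply, upperCoeffInv, pathMatrix,
    Matrix.of_apply]
  rw [Fin.sum_univ_eq_sum_range (fun t => (if t ≤ (s : ℕ) then
    (b.choose (s - t) : ℚ) / (c + s).choose s else 0) * denom b c t *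
    (if t ≤ (r : ℕ) then (c.choose (r - t) : ℚ) / (b + r).choose r else 0)) a]
  have e : ∑ t ∈ range a, (if t ≤ (s : ℕ) then
      (b.choose (s - t) : ℚ) / (c + s).choose s else 0) * denom b c t *
      (if t ≤ (r : ℕ) then (c.choose (r - t) : ℚ) / (b + r).choose r else 0) =
      ∑ t ∈ range (s + 1 : ℕ), (b + c).choose b / ((c + s).choose s * (b + r).choose r : ℚ) *
        (((if t ≤ (r : ℕ) then b.choose (s - t) * c.choose (r - t) else 0) *
        (b + c + t).choose t : ℕ) : ℚ) := by
    symm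
    refine sum_subset_zero_on_sdiff (fun j => by simp; omega) ?_ ?_
    · intro j hj
      simp only [mem_sdiff, mem_range] at hj
      rw [if_neg (by omega), zero_mul, zero_mul]
    · intro j hj
      simp only [mem_range] at hj
      rw [if_pos (show j ≤ (s : ℕ) by omega), denom_eq]
      split_ifs
      · push_cast; ring
      · simp
  rw [e, ← mul_sum, ← Nat.cast_sum, sum_choose_mul_choose_mul_choose]
  have h := choose_mul_choose_mul_choose_eq b c s r
  have p1 : ((c + s).choose s : ℚ) ≠ 0 := by
    exact_mod_cast (Nat.choose_pos (show (s : ℕ) ≤ c + s by omega)).ne'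
  have p2 : ((b + r).choose r : ℚ) ≠ 0 := by
    exact_mod_cast (Nat.choose_pos (show (r : ℕ) ≤ b + r by omega)).ne'
  rw [div_mul_eq_mul_div, div_eq_iff (mul_ne_zero p1 p2), ← mul_assoc, ← h]
  push_cast; ring

theorem upperCoeff_mul_pathMatrix (a b c : ℕ) (hb : 0 < b) (hc : 0 < c) :
    upperCoeff a b c * Matrix.diagonal (fun i : Fin a => (denom b c i)⁻¹) *
      (upperCoeff a c b).transpose * pathMatrix a b c = 1 := by
  have h1 : (upperCoeff a c b).transpose * (upperCoeffInv a c b).transpose = 1 := by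
    rw [← Matrix.transpose_mul,
      mul_eq_one_comm.mp (upperCoeff_mul_upperCoeffInv a c b hb), Matrix.transpose_one]
  have h2 : Matrix.diagonal (fun i : Fin a => (denom b c i)⁻¹) *
      Matrix.diagonal (fun i : Fin a => denom b c i) = 1 := by
    rw [Matrix.diagonal_mul_diagonal, ← Matrix.diagonal_one]
    congr 1; ext i
    exact inv_mul_cancel₀ (denom_ne_zero b c i)
  rw [← transpose_mul_diagonal_mul]
  simp only [← Matrix.mul_assoc]
  rw [Matrix.mul_assoc _ (upperCoeff a c b).transpose, h1, Matrix.mul_one,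
    Matrix.mul_assoc (upperCoeff a b c), h2, Matrix.mul_one, upperCoeff_mul_upperCoeffInv a b c hc]

/-! ### Passage from lattice path coordinates to line numbers. -/

/-- The sum `g` in terms of integral binomial arguments. -/
def corner (a b c : ℕ) (i : Fin a) (n k : ℤ) : ℚ :=
  ∑ j : Fin a, upperCoeff a b c j i * intBinom n (k - (j + 1))

/-- The function `entry` for arbitrary integral positions `(p, q)` of the white
and `(u, v)` of the black triangle. -/
def greenEntry (a b c : ℕ) (p q u v : ℤ) : ℚ :=
  intBinom (u - p) (u + v + 1 - p - q) -
    ∑ i : Fin a, corner a b c i u (u + v + 1 - b) * corner a c b i (b + c - p) q / denom b c i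

theorem sum_Icc_one_eq_sum_fin (a : ℕ) (F : ℕ → ℚ) :
    ∑ s ∈ Icc 1 a, F s = ∑ i : Fin a, F (i + 1) := by
  rw [Fin.sum_univ_eq_sum_range (fun i => F (i + 1)), range_eq_Ico,
    Finset.sum_Ico_add' F 0 a 1]
  rfl

theorem g_eq_corner (a b c : ℕ) (hc : 0 < c) (i : Fin a) (n k : ℤ) (x y : ℚ)
    (hn : (b : ℚ) / 2 + (c : ℚ) / 2 + x + y = n)
    (hk : x + (a : ℚ) / 2 + (c : ℚ) / 2 + 1 / 2 = k) :
    g a b c x y (i + 1) = corner a b c i n k := by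
  have e : g a b c x y (i + 1) = ∑ s ∈ Icc 1 a, if s ≤ (i : ℕ) + 1 then
      (-1 : ℚ) ^ ((i : ℕ) + 1 - s) * binom ((b : ℚ) + s - 1) ((s : ℚ) - 1) *
      binom ((c : ℚ) + (i + 1 : ℕ) - s - 1) ((c : ℚ) - 1) *
      binom ((b : ℚ) / 2 + (c : ℚ) / 2 + x + y)
        (x - s + (a : ℚ) / 2 + (c : ℚ) / 2 + 1 / 2) else 0 := by
    rw [g]
    refine sum_subset_zero_on_sdiff (fun j => by simp; omega) ?_ ?_
    · intro j hj
      simp only [mem_sdiff, mem_Icc] at hj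
      rw [if_neg (by omega)]
    · intro j hj
      simp only [mem_Icc] at hj
      rw [if_pos hj.2]
  rw [e, sum_Icc_one_eq_sum_fin, corner]
  refine sum_congr rfl fun j _ => ?_
  simp only [upperCoeff, Matrix.of_apply]
  by_cases h : (j : ℕ) ≤ i
  · rw [if_pos (by omega), if_pos h]
    have h1 : (b : ℚ) + (j + 1 : ℕ) - 1 = (b + j : ℕ) := by push_cast; ring
    have h2 : ((j + 1 : ℕ) : ℚ) - 1 = (j : ℕ) := by push_cast; ring
    have h3 : (c : ℚ) + (i + 1 : ℕ) - (j + 1 : ℕ) - 1 = (c - 1 + (i - j) : ℕ) := by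
      rw [Nat.cast_add (c - 1), Nat.cast_sub hc, Nat.cast_sub h]; push_cast; ring
    have h4 : (c : ℚ) - 1 = (c - 1 : ℕ) := by
      rw [Nat.cast_sub hc]; push_cast; ring
    have h5 : x - (j + 1 : ℕ) + (a : ℚ) / 2 + (c : ℚ) / 2 + 1 / 2 = (k - (j + 1) : ℤ) := by
      push_cast; rw [← hk]; ring
    rw [h1, h2, h3, h4, h5, hn, binom_natCast, binom_natCast, binom_intCast,
      Nat.add_sub_add_right]
  · rw [if_neg (by omega), if_neg h, zero_mul]

theorem entry_eq_greenEntry {a b c : ℕ} (hb : 0 < b) (hc : 0 < c) (ω : White a b c)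
    (β : Black a b c) : entry ω β = greenEntry a b c ω.1.1 ω.1.2 β.1.1 β.1.2 := by
  simp only [entry, greenEntry, psi, White.label, Black.label]
  congr 1
  · rw [← binom_intCast]
    congr 1 <;> push_cast <;> ring
  · rw [sum_Icc_one_eq_sum_fin]
    refine sum_congr rfl fun i _ => ?_
    congr 1
    · congr 1
      · apply g_eq_corner a b c hc <;> push_cast <;> ring
      · apply g_eq_corner a c b hb <;> push_cast <;> ring
    · rw [denom, ← binom_natCast, ← binom_natCast]
      congr 2 <;> push_cast <;> ring

/-! ### Recurrence and boundary values of the Green function. -/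

theorem corner_pascal (a b c : ℕ) (i : Fin a) (n k : ℤ) (hn : n ≠ 0) :
    corner a b c i n k = corner a b c i (n - 1) k + corner a b c i (n - 1) (k - 1) := by
  simp only [corner, ← sum_add_distrib, ← mul_add]
  refine sum_congr rfl fun j _ => ?_
  have h := intBinom_pascal n (k - (j + 1))
  rw [if_neg (by tauto)] at h
  rw [show k - 1 - ((j : ℤ) + 1) = k - (j + 1) - 1 by ring]
  congr 1
  linarith

/-- Excluding `p = b + c` keeps the correction term away from the defect of Pascal's rule, so only
the leading binomial contributes a source. -/
theorem greenEntry_pascal (a b c : ℕ) (p q u v : ℤ) (hp : p ≠ b + c) :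
    greenEntry a b c p (q + 1) u v - greenEntry a b c (p + 1) (q + 1) u v -
      greenEntry a b c (p + 1) q u v = if u = p ∧ v = q then 1 else 0 := by
  have h1 := intBinom_pascal (u - p) (u + v - p - q)
  have h2 : ∀ i : Fin a, corner a b c i u (u + v + 1 - b) *
      corner a c b i (b + c - p) (q + 1) / denom b c i =
      corner a b c i u (u + v + 1 - b) *
      corner a c b i (b + c - (p + 1)) (q + 1) / denom b c i +
      corner a b c i u (u + v + 1 - b) *
      corner a c b i (b + c - (p + 1)) q / denom b c i := by
    intro i
    rw [corner_pascal a c b i _ _ (show (b : ℤ) + c - p ≠ 0 by omega), sub_sub,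
      add_sub_cancel_right]
    ring
  simp only [greenEntry]
  rw [sum_congr rfl fun i _ => h2 i, sum_add_distrib,
    show u + v + 1 - p - (q + 1) = u + v - p - q by ring,
    show u - (p + 1) = u - p - 1 by ring,
    show u + v + 1 - (p + 1) - (q + 1) = u + v - p - q - 1 by ring,
    show u + v + 1 - (p + 1) - q = u + v - p - q by ring]
  have h3 : (if u = p ∧ v = q then (1 : ℚ) else 0) =
      if u - p = 0 ∧ u + v - p - q = 0 then 1 else 0 := by
    refine if_congr ⟨?_, ?_⟩ rfl rfl <;> omega
  rw [h3, ← h1]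
  ring

theorem corner_eq_zero {a b c : ℕ} {i : Fin a} {n k : ℤ} (h : k ≤ 0 ∨ n + a < k) :
    corner a b c i n k = 0 := by
  refine sum_eq_zero fun j _ => ?_
  have := j.2
  rcases h with h | h
  · rw [intBinom_of_neg (by omega), mul_zero]
  · rw [intBinom_of_lt (by omega), mul_zero]

/-- Positions with `q = 0` lie across line number `0` of `L₊`, the one that carries the north-west
side. -/
theorem greenEntry_eq_zero_of_south_east {a b c : ℕ} {p u v : ℤ} (hv : 0 ≤ v) :
    greenEntry a b c p 0 u v = 0 := by
  rw [greenEntry, intBinom_of_lt (by omega), zero_sub, neg_eq_zero]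
  exact sum_eq_zero fun i _ => by rw [corner_eq_zero (n := b + c - p) (Or.inl le_rfl)]; simp

theorem greenEntry_eq_zero_of_east {a b c : ℕ} {p q u v : ℤ} (hpq : p + q = a + b + c + 1)
    (huv : u + v < a + b + c) : greenEntry a b c p q u v = 0 := by
  rw [greenEntry, intBinom_of_neg (by omega), zero_sub, neg_eq_zero]
  exact sum_eq_zero fun i _ => by
    rw [corner_eq_zero (n := b + c - p) (Or.inr (by omega))]; simp

/-- At `p = 0` the second `corner` factor is a column of `(upperCoeff a c b)ᵀ * pathMatrix a b c`.
The correction is then a vector `φ` times the identity matrix, and its entry at `r` is the leading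
binomial. -/
theorem greenEntry_eq_zero_of_south_west {a b c : ℕ} (hb : 0 < b) (hc : 0 < c) {q u v : ℤ}
    (hq : b < q) (hq' : q ≤ a + b) : greenEntry a b c 0 q u v = 0 := by
  obtain ⟨r, rfl⟩ : ∃ r : Fin a, q = b + r + 1 :=
    ⟨⟨(q - b - 1).toNat, by omega⟩, by simp; omega⟩
  set φ : Fin a → ℚ := fun j => intBinom u (u + v + 1 - b - (j + 1)) with hφ
  have h1 : ∀ i : Fin a, corner a b c i u (u + v + 1 - b) =
      Matrix.vecMul φ (upperCoeff a b c) i := by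
    intro i
    simp only [corner, Matrix.vecMul, dotProduct, hφ]
    exact sum_congr rfl fun j _ => mul_comm _ _
  have h2 : ∀ i : Fin a, corner a c b i (b + c - 0) (b + r + 1) =
      ((upperCoeff a c b).transpose * pathMatrix a b c) i r := by
    intro i
    simp only [corner, Matrix.mul_apply, Matrix.transpose_apply, pathMatrix, Matrix.of_apply]
    refine sum_congr rfl fun j _ => ?_
    congr 2
    ring
  have h3 : ∑ i : Fin a, corner a b c i u (u + v + 1 - b) *
      corner a c b i (b + c - 0) (b + r + 1) / denom b c i =
      Matrix.vecMul φ (upperCoeff a b c * Matrix.diagonal (fun i : Fin a => (denom b c i)⁻¹) *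
      (upperCoeff a c b).transpose * pathMatrix a b c) r := by
    rw [Matrix.mul_assoc, Matrix.mul_assoc, ← Matrix.vecMul_vecMul, Matrix.vecMul, dotProduct]
    refine sum_congr rfl fun i _ => ?_
    rw [← h1, Matrix.diagonal_mul, ← h2]
    ring
  rw [greenEntry, h3, upperCoeff_mul_pathMatrix a b c hb hc, Matrix.vecMul_one]
  simp only [hφ]
  rw [sub_eq_zero]
  congr 1 <;> ring

/-! ### Adjacency in the hexagon and the product of the two matrices. -/

theorem mem_leftTriangles_iff {a b c : ℕ} {u v : ℤ} : (u, v) ∈ leftTriangles a b c ↔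
    (0 ≤ u ∧ u < b + c) ∧ (0 ≤ v ∧ v < a + b) ∧ (b ≤ u + v ∧ u + v < a + b + c) := by
  simp only [mem_leftTriangles, leftTriangle, mem_insert, mem_singleton, forall_eq_or_imp,
    forall_eq, InHexagon]
  omega

theorem mem_rightTriangles_iff {a b c : ℕ} {p q : ℤ} : (p, q) ∈ rightTriangles a b c ↔
    (0 < p ∧ p ≤ b + c) ∧ (0 < q ∧ q ≤ a + b) ∧ (b < p + q ∧ p + q ≤ a + b + c) := by
  simp only [mem_rightTriangles, rightTriangle, mem_insert, mem_singleton, forall_eq_or_imp,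
    forall_eq, InHexagon]
  omega

theorem card_leftTriangle_inter_rightTriangle (u v p q : ℤ) :
    (leftTriangle (u, v) ∩ rightTriangle (p, q)).card = 2 ↔
      (p, q) = (u, v + 1) ∨ (p, q) = (u + 1, v + 1) ∨ (p, q) = (u + 1, v) := by
  rw [← filter_mem_eq_inter, card_filter, leftTriangle, sum_insert (by simp), sum_insert (by simp),
    sum_singleton]
  simp only [rightTriangle, mem_insert, mem_singleton, Prod.mk.injEq]
  split_ifs <;> first | omega | (rw [false_iff]; omega)

theorem kasteleyn_mul_K (a b c : ℕ) (hb : 0 < b) (hc : 0 < c) :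
    kasteleyn a b c * K a b c = 1 := by
  ext ⟨⟨u', v'⟩, hβ'⟩ ⟨⟨u, v⟩, hβ⟩
  -- The sign flips between `k.1 = u'` and `k.1 = u' + 1`, which matches the signs in
  -- `greenEntry_pascal`.
  set F : ℤ × ℤ → ℚ := fun k => (-1 : ℚ) ^ (u - k.1) * greenEntry a b c k.1 k.2 u v with hF
  have e1 : (kasteleyn a b c * K a b c) ⟨(u', v'), hβ'⟩ ⟨(u, v), hβ⟩ =
      ∑ k ∈ rightTriangles a b c,
        if k ∈ ({(u', v' + 1), (u' + 1, v' + 1), (u' + 1, v')} : Finset (ℤ × ℤ))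
        then F k else 0 := by
    rw [Matrix.mul_apply, ← sum_coe_sort (rightTriangles a b c)]
    refine sum_congr rfl fun ω _ => ?_
    simp only [kasteleyn, K, Matrix.of_apply, ite_mul, one_mul, zero_mul, hF,
      entry_eq_greenEntry hb hc]
    refine if_congr ?_ rfl rfl
    obtain ⟨⟨p, q⟩, _⟩ := ω
    rw [Adj, card_leftTriangle_inter_rightTriangle]
    simp only [mem_insert, mem_singleton]
  have hu := mem_leftTriangles_iff.mp hβ
  have hu' := mem_leftTriangles_iff.mp hβ'
  rw [e1, ← sum_filter, filter_mem_eq_inter]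
  -- A left pointing triangle has edges facing south-west, east and north-west, so a neighbour can
  -- be missing only across those sides of the hexagon, where `greenEntry` is zero.
  have e2 : ∑ k ∈ rightTriangles a b c ∩ {(u', v' + 1), (u' + 1, v' + 1), (u' + 1, v')}, F k =
      ∑ k ∈ ({(u', v' + 1), (u' + 1, v' + 1), (u' + 1, v')} : Finset (ℤ × ℤ)), F k := by
    refine sum_subset inter_subset_right ?_
    intro k hk hk'
    have hk'' : k ∉ rightTriangles a b c := fun h => hk' (mem_inter.mpr ⟨h, hk⟩)
    simp only [mem_insert, mem_singleton] at hk
    simp only [hF]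
    rcases hk with rfl | rfl | rfl <;> rw [mem_rightTriangles_iff] at hk''
    · obtain rfl : u' = 0 := by omega
      rw [greenEntry_eq_zero_of_south_west hb hc (by omega) (by omega), mul_zero]
    · rw [greenEntry_eq_zero_of_east (by omega) (by omega), mul_zero]
    · obtain rfl : v' = 0 := by omega
      rw [greenEntry_eq_zero_of_south_east (by omega), mul_zero]
  rw [e2, sum_insert (by simp), sum_insert (by simp), sum_singleton, Matrix.one_apply]
  have h := greenEntry_pascal a b c u' v' u v (by omega)
  simp only [hF, ← sub_sub]
  rw [zpow_sub_one₀ (by norm_num : (-1 : ℚ) ≠ 0)]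
  have h4 : (if (⟨(u', v'), hβ'⟩ : Black a b c) = ⟨(u, v), hβ⟩ then (1 : ℚ) else 0) =
      if u = u' ∧ v = v' then 1 else 0 := by
    refine if_congr ?_ rfl rfl
    simp only [Subtype.mk.injEq, Prod.mk.injEq]
    omega
  rw [h4]
  have h5 : (-1 : ℚ) ^ (u - u') * (if u = u' ∧ v = v' then 1 else 0) =
      if u = u' ∧ v = v' then 1 else 0 := by
    split_ifs with h0
    · simp [h0.1]
    · simp
  rw [← h5, ← h]
  norm_num
  ring

/-! ### Counting the vertices. -/

theorem card_leftTriangles (a b c : ℕ) :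
    (leftTriangles a b c).card = a * b + b * c + c * a := by
  -- The hexagon is cut into three parallelograms, with sides `a, b`, then `c, a`, then `b, c`; each
  -- is a box in the numbers of two of the three line families.
  have e : leftTriangles a b c =
      (Ico (0 : ℤ) b ×ˢ Ico (b : ℤ) (a + b)).image (fun k => (k.1, k.2 - k.1)) ∪
      (Ico (b : ℤ) (b + c) ×ˢ Ico (0 : ℤ) a ∪
      (Ico (a + b : ℤ) (a + b + c) ×ˢ Ico (a : ℤ) (a + b)).image
        (fun k => (k.1 - k.2, k.2))) := by
    ext ⟨u, v⟩
    simp only [mem_leftTriangles_iff, mem_union, mem_image, mem_product, mem_Ico, Prod.exists,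
      Prod.mk.injEq]
    constructor
    · intro h
      by_cases h1 : u < b ∧ u + v < a + b
      · exact Or.inl ⟨u, u + v, by omega, rfl, by omega⟩
      by_cases h2 : b ≤ u ∧ v < a
      · exact Or.inr (Or.inl (by omega))
      · exact Or.inr (Or.inr ⟨u + v, v, by omega, by omega, rfl⟩)
    · rintro (⟨x, y, h⟩ | h | ⟨x, y, h⟩) <;> omega
  rw [e, card_union_of_disjoint, card_union_of_disjoint, card_image_of_injective,
    card_image_of_injective, card_product, card_product, card_product]
  · simp only [Int.card_Ico]
    rw [show ((b : ℤ) - 0).toNat = b by omega, show ((a : ℤ) + b - b).toNat = a by omega,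
      show ((b : ℤ) + c - b).toNat = c by omega, show ((a : ℤ) - 0).toNat = a by omega,
      show ((a : ℤ) + b + c - (a + b)).toNat = c by omega,
      show ((a : ℤ) + b - a).toNat = b by omega]
    ring
  · rintro ⟨x, y⟩ ⟨x', y'⟩ h
    simp only [Prod.mk.injEq] at h ⊢
    omega
  · rintro ⟨x, y⟩ ⟨x', y'⟩ h
    simp only [Prod.mk.injEq] at h ⊢
    omega
  · rw [disjoint_left]
    rintro ⟨u, v⟩ h h'
    simp only [mem_image, mem_product, mem_Ico, Prod.exists, Prod.mk.injEq] at h h'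
    obtain ⟨x, y, h'⟩ := h'
    omega
  · rw [disjoint_left]
    rintro ⟨u, v⟩ h h'
    simp only [mem_union, mem_image, mem_product, mem_Ico, Prod.exists, Prod.mk.injEq] at h h'
    obtain ⟨x, y, h⟩ := h
    rcases h' with h' | ⟨x', y', h'⟩ <;> omega

theorem card_rightTriangles (a b c : ℕ) :
    (rightTriangles a b c).card = a * b + b * c + c * a := by
  rw [← card_leftTriangles]
  -- Point reflection in the centre of the hexagon exchanges the colours.
  refine card_bij' (fun k _ => ((b : ℤ) + c - k.1, (a : ℤ) + b - k.2))
    (fun k _ => ((b : ℤ) + c - k.1, (a : ℤ) + b - k.2)) ?_ ?_ ?_ ?_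
  · rintro ⟨p, q⟩ h
    rw [mem_rightTriangles_iff] at h
    rw [mem_leftTriangles_iff]
    omega
  · rintro ⟨u, v⟩ h
    rw [mem_leftTriangles_iff] at h
    rw [mem_rightTriangles_iff]
    omega
  · intros; simp
  · intros; simp

/-! ### Signs of consistent labellings. -/

theorem neg_one_zpow_eq_of_even_sub {m n : ℤ} (h : Even (m - n)) :
    (-1 : ℚ) ^ m = (-1) ^ n := by
  rw [show m = (m - n) + n by ring, zpow_add₀ (by norm_num), h.neg_one_zpow, one_mul]

theorem Consistent.even_sub {n : ℕ} {line : Fin n → ℤ} (h : Consistent line) (i j : Fin n) :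
    Even ((line i - i) - (line j - j)) := by
  have h1 := h i j
  rw [show line i - i - (line j - j) = (line i - line j) - ((i : ℤ) - j) by ring, Int.even_sub]
  exact h1.symm

/-- Within each colour, line number minus label has constant parity, so the two sign conventions
differ by one global sign, read off from the first vertex of each colour. -/
theorem submatrix_K_eq {a b c n : ℕ} (B : Fin n ≃ Black a b c) (w : Fin n ≃ White a b c)
    (hB : Consistent fun j => (B j).1.1) (hw : Consistent fun i => (w i).1.1) :
    (K a b c).submatrix w B = labelledK w B ∨ (K a b c).submatrix w B = -labelledK w B := by
  rcases n.eq_zero_or_pos with rfl | hn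
  · exact Or.inl (Subsingleton.elim _ _)
  let o : Fin n := ⟨0, hn⟩
  have key : ∀ i j, (K a b c).submatrix w B i j =
      (-1 : ℚ) ^ ((B o).1.1 - (w o).1.1) * labelledK w B i j := by
    intro i j
    simp only [Matrix.submatrix_apply, K, labelledK, Matrix.of_apply]
    rw [← mul_assoc, ← zpow_natCast, ← zpow_add₀ (by norm_num : (-1 : ℚ) ≠ 0)]
    congr 1
    apply neg_one_zpow_eq_of_even_sub
    obtain ⟨x, hx⟩ := hB.even_sub j o
    obtain ⟨y, hy⟩ := hw.even_sub i o
    simp only [o, Nat.cast_zero, sub_zero] at hx hy ⊢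
    exact ⟨x - y - i - 1, by push_cast; linarith⟩
  rcases Int.even_or_odd ((B o).1.1 - (w o).1.1) with h | h
  · left
    ext i j
    rw [key, h.neg_one_zpow, one_mul]
  · right
    ext i j
    rw [key, h.neg_one_zpow, neg_one_mul, Matrix.neg_apply]

end HexKasteleyn

theorem theorem1 (a b c : ℕ) (ha : 0 < a) (hb : 0 < b) (hc : 0 < c) :
    Fintype.card (HexKasteleyn.Black a b c) = a * b + b * c + c * a ∧
    Fintype.card (HexKasteleyn.White a b c) = a * b + b * c + c * a ∧
    HexKasteleyn.kasteleyn a b c * HexKasteleyn.K a b c = 1 ∧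
    HexKasteleyn.K a b c * HexKasteleyn.kasteleyn a b c = 1 ∧
    ∀ (B : Fin (a * b + b * c + c * a) ≃ HexKasteleyn.Black a b c)
      (w : Fin (a * b + b * c + c * a) ≃ HexKasteleyn.White a b c),
      HexKasteleyn.Consistent (fun j => (B j).1.1) →
      HexKasteleyn.Consistent (fun i => (w i).1.1) →
      IsUnit ((HexKasteleyn.kasteleyn a b c).submatrix B w).det ∧
      (((HexKasteleyn.kasteleyn a b c).submatrix B w)⁻¹ = HexKasteleyn.labelledK w B ∨
        ((HexKasteleyn.kasteleyn a b c).submatrix B w)⁻¹ = -HexKasteleyn.labelledK w B) := by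
  have hB : Fintype.card (HexKasteleyn.Black a b c) = a * b + b * c + c * a := by
    rw [Fintype.card_coe, HexKasteleyn.card_leftTriangles]
  have hW : Fintype.card (HexKasteleyn.White a b c) = a * b + b * c + c * a := by
    rw [Fintype.card_coe, HexKasteleyn.card_rightTriangles]
  have hAK := HexKasteleyn.kasteleyn_mul_K a b c hb hc
  refine ⟨hB, hW, hAK,
    (Matrix.mul_eq_one_comm_of_equiv (Fintype.equivOfCardEq (hB.trans hW.symm))).mp hAK, ?_⟩
  intro B w hBc hwc
  have h : (HexKasteleyn.kasteleyn a b c).submatrix B w * (HexKasteleyn.K a b c).submatrix w B =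
      1 := by
    rw [Matrix.submatrix_mul_equiv, hAK, Matrix.submatrix_one_equiv]
  refine ⟨Matrix.isUnit_det_of_right_inverse h, ?_⟩
  rw [Matrix.inv_eq_right_inv h]
  exact HexKasteleyn.submatrix_K_eq B w hBc hwc
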